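/- Let $K$ be an algebraically closed field of characteristic $0$. Let $u,h\in K[x,y]$ and $v\in K[x,y,z]$, and let $H=(u(x,y),v(x,y,z),h(x,y))$, a polynomial map $K^3\to K^3$. Write $Q_y=\partial Q/\partial y$ and let $\deg_y Q$ be the degree of $Q$ in $y$. For $p\in K[x,y]$ let $V(p)\subseteq K^2$ be its zero set, with the Zariski topology. Assume that - $H(0)=0$, - $u,v,h$ are linearly independent over $K$, - the Jacobian matrix $JH$ is nilpotent, - for every $Q\in K[x,y]$ such that $Q_y$ divides both $u_y$ and $h_y$ and $\deg_y Q$ divides $\gcd(\deg_y u,\deg_y h)$, the variety $V(Q_y)$ is irreducible or empty (it is empty exactly when $Q_y$ is a nonzero constant). Then there are $v_1,c_0,a\in K\setminus\{0\}$, $l_1,l_2,\tilde l_2\in K$ and a polynomial $g\in K[t]$ with $g(0)=0$ and $\deg g\ge 1$ such that, with $b(x)=v_1c_0a\,x^2+l_1x+\tilde l_2$, $$u=g(ay+b(x)),\qquad v=v_1z-a^{-1}b'(x)\,g(ay+b(x))-v_1l_2x,\qquad h=c_0u^2+l_2u .$$ -/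

import Mathlib

open MvPolynomial

/-- The Jacobian matrix `(∂Hᵢ/∂xⱼ)` of a polynomial map `H`. -/
noncomputable def jacobianMatrix {K : Type*} [CommRing K] {n : ℕ}
    (H : Fin n → MvPolynomial (Fin n) K) : Matrix (Fin n) (Fin n) (MvPolynomial (Fin n) K) :=
  Matrix.of fun i j => pderiv j (H i)

/-- A polynomial in `x, y` (variables `0, 1`) regarded as a polynomial in `x, y, z`
(variables `0, 1, 2`). -/
noncomputable def liftXY {K : Type*} [CommRing K] (p : MvPolynomial (Fin 2) K) :
    MvPolynomial (Fin 3) K :=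
  rename Fin.castSucc p

/-- The polynomial map `H = (u(x, y), v(x, y, z), h(x, y))`. -/
noncomputable def mapUVH {K : Type*} [CommRing K] (u : MvPolynomial (Fin 2) K)
    (v : MvPolynomial (Fin 3) K) (h : MvPolynomial (Fin 2) K) :
    Fin 3 → MvPolynomial (Fin 3) K :=
  ![liftXY u, v, liftXY h]

/-- The Zariski topology on affine `n`-space `Kⁿ`: the closed sets are the common zero sets of
ideals of polynomials. -/
@[reducible]
def zariskiTopology (K : Type*) [Field K] (n : ℕ) : TopologicalSpace (Fin n → K) :=
  TopologicalSpace.ofClosed {Z | ∃ I : Ideal (MvPolynomial (Fin n) K), Z = zeroLocus K I}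
    ⟨⊤, by simp⟩
    (by
      intro A hA
      refine ⟨sSup {I | zeroLocus K I ∈ A}, Set.Subset.antisymm ?_ ?_⟩
      · refine le_zeroLocus_iff_le_vanishingIdeal.mpr ?_
        refine sSup_le fun I hI => ?_
        exact le_zeroLocus_iff_le_vanishingIdeal.mp (Set.sInter_subset_of_mem hI)
      · refine Set.subset_sInter fun Z hZ => ?_
        obtain ⟨I, rfl⟩ := hA hZ
        exact zeroLocus_anti_mono (le_sSup (by exact hZ)))
    (by
      rintro _ ⟨I, rfl⟩ _ ⟨J, rfl⟩
      refine ⟨I * J, Set.Subset.antisymm ?_ ?_⟩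
      · exact Set.union_subset (zeroLocus_anti_mono (Ideal.mul_le_inf.trans inf_le_left))
          (zeroLocus_anti_mono (Ideal.mul_le_inf.trans inf_le_right))
      · intro x hx
        by_contra hne
        simp only [Set.mem_union, mem_zeroLocus_iff, not_or, not_forall] at hne
        obtain ⟨⟨p, hp, hpx⟩, ⟨q, hq, hqx⟩⟩ := hne
        have hpq := mem_zeroLocus_iff.mp hx (p * q) (Ideal.mul_mem_mul hp hq)
        rw [map_mul] at hpq
        exact (mul_ne_zero hpx hqx) hpq)

/-- The plane curve `V(p) ⊆ K²` cut out by `p ∈ K[x, y]`. -/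
def planeVariety {K : Type*} [Field K] (p : MvPolynomial (Fin 2) K) : Set (Fin 2 → K) :=
  zeroLocus K (Ideal.span {p})

/-- A subset of the plane `K²` is irreducible for the Zariski topology: it is nonempty and not
covered by two Zariski closed sets neither of which contains it. -/
def IsIrreducibleVariety {K : Type*} [Field K] (V : Set (Fin 2 → K)) : Prop :=
  @IsIrreducible (Fin 2 → K) (zariskiTopology K 2) V

/-! Subscripts denote partial derivatives. Nilpotency of `JH` gives u_x + v_y = 0, u_x² + u_y v_x +
v_z h_y = 0 and v_z (u_x h_y - u_y h_x) = 0. Comparing powers of z and using linear independence, v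
= w(x, y) + cz with c constant (`eq_C_add_C_mul_X_of_relations`); what remains concerns u, w and η =
ch in K[x][y].

The heart is that u_y divides u_x. The relations give u_y ∣ u_x³. A degree comparison in x shows
that the leading coefficient of u in y is constant (`natDegree_coeff_natDegree_eq_zero`), so every
prime factor p of u_y involves y and cannot divide p_y. Then the symmetry (u_x)_y = (u_y)_x lowers
the exponent from 3 to 1 (`dvd_of_dvd_pow_of_derivation_eq`).

Degrees in y now give u_x = B'(x) u_y, so u = g(y + B(x)). Applying ∂_x - B'∂_y to the second
relation forces B''' = 0, and integration determines w and η (`structure_of_relations`). Iterated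
polynomial rings make degrees and coefficients in a single variable available; injective maps carry
the identities back. -/

namespace Polynomial

/-! ### Coefficientwise derivations and a divisibility criterion -/

section Derivations

variable {R A : Type*} [CommRing R] [CommRing A] [Algebra R A]

/-- The derivation of `A[X]` that applies a derivation of `A` to each coefficient. -/
noncomputable def coeffDeriv (d : Derivation R A A) : Derivation R A[X] A[X] :=
  PolynomialModule.equivPolynomialSelf.toLinearMap.compDer d.mapCoeffs

theorem coeff_coeffDeriv (d : Derivation R A A) (p : A[X]) (n : ℕ) :
    (coeffDeriv d p).coeff n = d (p.coeff n) := rfl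

theorem coeffDeriv_C (d : Derivation R A A) (a : A) : coeffDeriv d (C a) = C (d a) := by
  ext n
  rw [coeff_coeffDeriv, coeff_C, coeff_C]
  split_ifs <;> simp

theorem coeffDeriv_X (d : Derivation R A A) : coeffDeriv d X = 0 := by
  ext n
  rw [coeff_coeffDeriv, coeff_X]
  split_ifs <;> simp

theorem derivative_coeffDeriv (d : Derivation R A A) (p : A[X]) :
    derivative (coeffDeriv d p) = coeffDeriv d (derivative p) := by
  ext n
  rw [coeff_coeffDeriv, coeff_derivative, coeff_derivative, coeff_coeffDeriv, Derivation.leibniz]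
  have : d ((n : A) + 1) = 0 := by simp
  rw [this]
  simp [mul_comm]

theorem natDegree_coeffDeriv_le (d : Derivation R A A) (p : A[X]) :
    (coeffDeriv d p).natDegree ≤ p.natDegree := by
  rw [natDegree_le_iff_coeff_eq_zero]
  intro n hn
  rw [coeff_coeffDeriv, coeff_eq_zero_of_natDegree_lt hn, map_zero]

theorem coeffDeriv_comp (d : Derivation R A A) (p q : A[X]) :
    coeffDeriv d (p.comp q)
      = (coeffDeriv d p).comp q + (derivative p).comp q * coeffDeriv d q := by
  induction p using Polynomial.induction_on' with
  | add p₁ p₂ h₁ h₂ => simp only [add_comp, map_add, h₁, h₂]; ring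
  | monomial n a =>
    rw [← C_mul_X_pow_eq_monomial]
    simp only [mul_comp, C_comp, pow_comp, X_comp, Derivation.leibniz, Derivation.leibniz_pow,
      coeffDeriv_C, coeffDeriv_X, derivative_C_mul_X_pow, smul_eq_mul, nsmul_eq_mul]
    simp
    ring

/-- If `D b = E a` and no prime factor `p` of `a` divides `D p`, then `a ∣ bᵏ` implies `a ∣ b`. -/
theorem dvd_of_dvd_pow_of_derivation_eq {k S : Type*} [Field k] [CharZero k] [CommRing S]
    [IsDomain S] [UniqueFactorizationMonoid S] [Algebra k S] (D E : Derivation k S S) {a b : S}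
    {n : ℕ} (ha : a ≠ 0) (hab : D b = E a) (hn : a ∣ b ^ n)
    (hp : ∀ p, Prime p → p ∣ a → ¬ p ∣ D p) : a ∣ b := by
  rw [UniqueFactorizationMonoid.dvd_iff_emultiplicity_le ha]
  intro p hpp
  rw [emultiplicity_le_emultiplicity_iff]
  intro m
  induction m with
  | zero => simp
  | succ m ih =>
    intro hm
    have hpa : p ∣ a := (dvd_pow_self p m.succ_ne_zero).trans hm
    -- The hypothesis a ∣ bⁿ is needed only here, to get p ∣ b; higher powers of p come from D b = E
    -- a.
    rcases m.eq_zero_or_pos with rfl | hm0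
    · simpa using hpp.dvd_of_dvd_pow (hpa.trans hn)
    obtain ⟨r, rfl⟩ : ∃ r, m = r + 1 := ⟨m - 1, by omega⟩
    obtain ⟨A, rfl⟩ := ih ((pow_dvd_pow p (Nat.le_succ _)).trans hm)
    obtain ⟨M, rfl⟩ := hm
    simp only [Derivation.leibniz, Derivation.leibniz_pow, smul_eq_mul, nsmul_eq_mul,
      Nat.add_sub_cancel] at hab
    -- D b = E a with b = p^(r+1) A and a = p^(r+2) M, expanded and with p^r factored out.
    -- Cancelling leaves p ∣ (r+1) (D p) A, hence p ∣ A.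
    have h0 : p ^ r * (((r + 1 : ℕ) : S) * D p * A)
        = p ^ r * (p * (((r + 2 : ℕ) : S) * E p * M + p * E M - D A)) := by
      push_cast at hab ⊢
      linear_combination hab
    have h1 : p ∣ ((r + 1 : ℕ) : S) * D p * A :=
      ⟨_, mul_left_cancel₀ (pow_ne_zero r hpp.ne_zero) h0⟩
    have hu : IsUnit ((r + 1 : ℕ) : S) := by
      have : IsUnit ((r + 1 : ℕ) : k) := (Nat.cast_ne_zero.mpr r.succ_ne_zero).isUnit
      simpa using this.map (algebraMap k S)
    rw [mul_assoc, hu.dvd_mul_left] at h1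
    rw [pow_succ]
    exact mul_dvd_mul_left _ ((hpp.dvd_or_dvd h1).resolve_left (hp p hpp hpa))

end Derivations

/-! ### Antiderivatives and a degree argument in one variable -/

section Univariate

variable {K : Type*} [Field K] [CharZero K]

theorem exists_derivative_eq (c : K[X]) : ∃ B : K[X], derivative B = c ∧ B.eval 0 = 0 := by
  induction c using Polynomial.induction_on' with
  | add p q hp hq =>
    obtain ⟨P, hP, hP0⟩ := hp
    obtain ⟨Q, hQ, hQ0⟩ := hq
    exact ⟨P + Q, by simp [hP, hQ], by simp [hP0, hQ0]⟩
  | monomial n a =>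
    refine ⟨monomial (n + 1) (a / (n + 1)), ?_, by simp⟩
    have : (n : K) + 1 ≠ 0 := by exact_mod_cast n.succ_ne_zero
    rw [derivative_monomial]
    simp [this]

/-- A polynomial `A` for which some `E` has the two relations below is constant. -/
theorem natDegree_eq_zero_of_derivative_relations {n : ℕ} (hn : 1 ≤ n) {A E : K[X]}
    (h₁ : C ((n : K) + 1) * derivative A ^ 2 - C (n : K) * (A * derivative (derivative A))
      + C (((n : K) + 1) * (2 * n + 1)) * E = 0)
    (h₂ : C (2 * (n : K) + 1) * (E * derivative A) = C (n : K) * (A * derivative E)) :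
    A.natDegree = 0 := by
  by_contra he
  obtain ⟨e, he⟩ := Nat.exists_eq_succ_of_ne_zero he
  have ha : A.coeff (e + 1) ≠ 0 := by
    rw [← Nat.succ_eq_add_one, ← he]
    exact leadingCoeff_ne_zero.mpr (by rintro rfl; simp at he)
  have hn1 : (n : K) + 1 ≠ 0 := by exact_mod_cast n.succ_ne_zero
  have hn2 : 2 * (n : K) + 1 ≠ 0 := by exact_mod_cast (2 * n).succ_ne_zero
  have hn0 : (n : K) ≠ 0 := by exact_mod_cast (by omega : n ≠ 0)
  have he1 : (e : K) + 1 ≠ 0 := by exact_mod_cast e.succ_ne_zero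
  have hA' : (derivative A).natDegree ≤ e := (natDegree_derivative_le A).trans (by omega)
  have hA'' : (derivative (derivative A)).natDegree ≤ e - 1 :=
    (natDegree_derivative_le _).trans (by omega)
  have c1 : (derivative A ^ 2).coeff (e + e) = (A.coeff (e + 1) * (e + 1)) ^ 2 := by
    rw [pow_two, coeff_mul_add_eq_of_natDegree_le hA' hA', coeff_derivative, pow_two]
  have c2 : (A * derivative (derivative A)).coeff (e + e) = A.coeff (e + 1) ^ 2 * ((e + 1) * e) := by
    -- At e = 0 the bound `e - 1` truncates to 0 and the degrees no longer add up to 2e; there A'' =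
    -- 0 instead.
    rcases e.eq_zero_or_pos with rfl | hepos
    · have : derivative (derivative A) = 0 := by
        rw [derivative_eq_zero]; omega
      simp [this]
    · obtain ⟨r, rfl⟩ : ∃ r, e = r + 1 := ⟨e - 1, by omega⟩
      have : r + 1 + (r + 1) = (r + 2) + r := by omega
      rw [this, coeff_mul_add_eq_of_natDegree_le (by omega) (by simpa using hA''),
        coeff_derivative, coeff_derivative]
      push_cast; ring
  have c3 := congrArg (fun p : K[X] => p.coeff (e + e)) h₁
  simp only [coeff_add, coeff_sub, coeff_C_mul, c1, c2, coeff_zero] at c3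
  -- With d = e + 1 = deg A and leading coefficient α, the terms of `h₁` in A contribute α² d (n +
  -- d) ≠ 0 at x^(2e), so E must cancel it.
  have hE0 : E.coeff (e + e) ≠ 0 := by
    intro h0
    rw [h0] at c3
    have : A.coeff (e + 1) ^ 2 * ((e + 1) * ((n : K) + e + 1)) = 0 := by linear_combination c3
    have h3 : (n : K) + e + 1 ≠ 0 := by exact_mod_cast (n + e).succ_ne_zero
    exact mul_ne_zero (pow_ne_zero 2 ha) (mul_ne_zero he1 h3) this
  have hEdeg : E.natDegree ≤ e + e := by
    rw [natDegree_le_iff_coeff_eq_zero]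
    intro N hN
    have c4 := congrArg (fun p : K[X] => p.coeff N) h₁
    have d1 : (derivative A ^ 2).coeff N = 0 := by
      refine coeff_eq_zero_of_natDegree_lt (lt_of_le_of_lt ?_ hN)
      rw [pow_two]; exact natDegree_mul_le_of_le hA' hA'
    have d2 : (A * derivative (derivative A)).coeff N = 0 := by
      rcases e.eq_zero_or_pos with rfl | hepos
      · have : derivative (derivative A) = 0 := by
          rw [derivative_eq_zero]; omega
        simp [this]
      · refine coeff_eq_zero_of_natDegree_lt (lt_of_le_of_lt ?_ hN)
        exact (natDegree_mul_le_of_le he.le hA'').trans (by omega)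
    simp only [coeff_add, coeff_sub, coeff_C_mul, d1, d2, coeff_zero] at c4
    simpa [hn1, hn2] using c4
  -- Now deg E = 2d - 2 exactly. Leading coefficients in `h₂` would need (2n + 1) d = n (2d - 2),
  -- yet the difference is 2n + d > 0. For d = 1, E is constant and E A' ≠ 0 contradicts `h₂`.
  rcases e.eq_zero_or_pos with rfl | hepos
  · have hE : E = C (E.coeff 0) := eq_C_of_natDegree_eq_zero (by omega)
    have hE' : derivative E = 0 := by rw [hE, derivative_C]
    rw [hE', mul_zero, mul_zero] at h₂
    have c5 := congrArg (fun p : K[X] => p.coeff (0 + 0)) h₂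
    simp only [coeff_C_mul] at c5
    rw [coeff_mul_add_eq_of_natDegree_le (by omega) hA', coeff_derivative, coeff_zero] at c5
    have h4 : A.coeff (0 + 1) * (((0 : ℕ) : K) + 1) ≠ 0 := mul_ne_zero ha he1
    exact mul_ne_zero hn2 (mul_ne_zero hE0 h4) c5
  · obtain ⟨r, rfl⟩ : ∃ r, e = r + 1 := ⟨e - 1, by omega⟩
    have hE' : (derivative E).natDegree ≤ r + 1 + r :=
      (natDegree_derivative_le _).trans (by omega)
    have c5 := congrArg (fun p : K[X] => p.coeff ((r + 1 + (r + 1)) + (r + 1))) h₂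
    simp only [coeff_C_mul] at c5
    rw [coeff_mul_add_eq_of_natDegree_le hEdeg hA',
      show (r + 1 + (r + 1)) + (r + 1) = (r + 2) + (r + 1 + r) by omega,
      coeff_mul_add_eq_of_natDegree_le (by omega) hE', coeff_derivative, coeff_derivative] at c5
    have e1 : r + 1 + r + 1 = r + 1 + (r + 1) := by omega
    rw [e1] at c5
    push_cast at c5
    have c6 : E.coeff (r + 1 + (r + 1)) * A.coeff (r + 1 + 1) * (2 * n + r + 2 : K) = 0 := by
      linear_combination c5
    have h3 : (2 * n + r + 2 : K) ≠ 0 := by exact_mod_cast (by omega : 2 * n + r + 2 ≠ 0)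
    exact mul_ne_zero (mul_ne_zero hE0 ha) h3 c6

end Univariate
end Polynomial

namespace Polynomial

/-! ### The relations in K[x][y] -/

section Bivariate

variable {K : Type*} [Field K] [CharZero K]

/-- The derivation `∂/∂x` of `K[x][y]`. -/
noncomputable abbrev derivX (K : Type*) [Field K] : Derivation K K[X][X] K[X][X] :=
  coeffDeriv derivative'

omit [CharZero K] in
theorem derivX_C (a : K[X]) : derivX K (C a) = C (derivative a) := coeffDeriv_C _ _

omit [CharZero K] in
theorem coeff_derivX (p : K[X][X]) (n : ℕ) :
    (derivX K p).coeff n = derivative (p.coeff n) := rfl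

/-- A polynomial in `x` and `y` both of whose partial derivatives vanish is constant. -/
theorem eq_C_C_of_derivatives_eq_zero {p : K[X][X]} (hy : derivative p = 0)
    (hx : derivX K p = 0) : p = C (C ((p.coeff 0).coeff 0)) := by
  have h := eq_C_of_derivative_eq_zero hy
  rw [h, derivX_C, C_eq_zero] at hx
  rw [← eq_C_of_derivative_eq_zero hx, ← h]

/-- Let n = deg_y u, A the coefficient of yⁿ in u and E that of y^(2n+1) in η. The coefficients of
yⁿ in `h₁` (differentiated in x), y^(2n) in `h₂` and y^(3n) in `h₃` combine into the two relations
of `natDegree_eq_zero_of_derivative_relations`. -/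
theorem natDegree_coeff_natDegree_eq_zero {u v η : K[X][X]} (hu : derivative u ≠ 0)
    (h₁ : derivative v = -derivX K u)
    (h₂ : derivX K u ^ 2 + derivative u * derivX K v + derivative η = 0)
    (h₃ : derivX K u * derivative η = derivative u * derivX K η) :
    (u.coeff u.natDegree).natDegree = 0 := by
  obtain ⟨m, hm⟩ : ∃ m, u.natDegree = m + 1 :=
    Nat.exists_eq_succ_of_ne_zero (derivative_ne_zero.mp hu)
  have hux : (derivX K u).natDegree ≤ m + 1 := hm ▸ natDegree_coeffDeriv_le _ u
  have huy : (derivative u).natDegree ≤ m := (natDegree_derivative_le u).trans (by omega)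
  have hv : v.natDegree ≤ m + 2 := by
    have := congrArg natDegree h₁
    rw [natDegree_derivative, natDegree_neg] at this
    omega
  have hvx : (derivX K v).natDegree ≤ m + 2 := (natDegree_coeffDeriv_le _ v).trans hv
  have hηy : (derivative η).natDegree ≤ m + 1 + (m + 1) := by
    rw [show derivative η = -(derivX K u * derivX K u + derivative u * derivX K v) by
      linear_combination h₂, natDegree_neg]
    refine (natDegree_add_le _ _).trans (max_le ?_ ?_)
    · exact natDegree_mul_le_of_le hux hux
    · exact (natDegree_mul_le_of_le huy hvx).trans (by omega)
  have hη : η.natDegree ≤ m + 1 + (m + 1) + 1 := by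
    rw [natDegree_derivative] at hηy
    omega
  have hηx : (derivX K η).natDegree ≤ m + 1 + (m + 1) + 1 :=
    (natDegree_coeffDeriv_le _ η).trans hη
  rw [hm]
  have c1 := congrArg (fun p : K[X][X] => derivative (p.coeff (m + 1))) h₁
  simp only [coeff_derivative, coeff_neg, coeff_derivX, derivative_mul, derivative_neg] at c1
  have c2 := congrArg (fun p : K[X][X] => p.coeff (m + 1 + (m + 1))) h₂
  simp only [coeff_add, coeff_zero] at c2
  rw [pow_two, coeff_mul_add_eq_of_natDegree_le hux hux,
    show m + 1 + (m + 1) = m + (m + 2) by omega,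
    coeff_mul_add_eq_of_natDegree_le huy hvx, coeff_derivative, coeff_derivative,
    coeff_derivX, coeff_derivX] at c2
  have c3 := congrArg (fun p : K[X][X] => p.coeff ((m + 1) + (m + 1 + (m + 1)))) h₃
  rw [coeff_mul_add_eq_of_natDegree_le hux hηy,
    show (m + 1) + (m + 1 + (m + 1)) = m + (m + 1 + (m + 1) + 1) by omega,
    coeff_mul_add_eq_of_natDegree_le huy hηx, coeff_derivative, coeff_derivative,
    coeff_derivX, coeff_derivX] at c3
  have e1 : m + (m + 2) + 1 = m + 1 + (m + 1) + 1 := by omega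
  rw [e1] at c2
  refine natDegree_eq_zero_of_derivative_relations (n := m + 1) (by omega)
    (A := u.coeff (m + 1)) (E := η.coeff (m + 1 + (m + 1) + 1)) ?_ ?_
  · simp at c1
    simp only [map_add, map_mul, map_natCast, map_one, map_ofNat] at c2 ⊢
    push_cast at c1 c2 ⊢
    linear_combination ((m : K[X]) + 2) * c2 - (u.coeff (m + 1)) * ((m : K[X]) + 1) * c1
  · simp only [map_add, map_mul, map_natCast, map_one, map_ofNat]
    push_cast at c3 ⊢
    linear_combination c3

theorem exists_derivX_eq_C_mul_derivative {u v η : K[X][X]} (hu : derivative u ≠ 0)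
    (h₁ : derivative v = -derivX K u)
    (h₂ : derivX K u ^ 2 + derivative u * derivX K v + derivative η = 0)
    (h₃ : derivX K u * derivative η = derivative u * derivX K η) :
    ∃ c : K[X], derivX K u = C c * derivative u := by
  have hlc := natDegree_coeff_natDegree_eq_zero hu h₁ h₂ h₃
  have hdeg : u.natDegree ≠ 0 := derivative_ne_zero.mp hu
  have hlc0 : u.leadingCoeff ≠ 0 := leadingCoeff_ne_zero.mpr (by rintro rfl; simp at hu)
  have hlcu : IsUnit (derivative u).leadingCoeff := by
    rw [leadingCoeff, natDegree_derivative, coeff_derivative,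
      Nat.sub_add_cancel (Nat.one_le_iff_ne_zero.mpr hdeg)]
    have h0 : (u.coeff u.natDegree * (((u.natDegree - 1 : ℕ) : K[X]) + 1)).natDegree = 0 := by
      rw [← Nat.cast_succ, ← map_natCast (C : K →+* K[X])]
      exact Nat.le_zero.mp ((natDegree_mul_C_le _ _).trans hlc.le)
    rw [isUnit_iff_degree_eq_zero, degree_eq_natDegree, h0]
    · rfl
    · refine mul_ne_zero hlc0 ?_
      exact_mod_cast Nat.succ_ne_zero (u.natDegree - 1)
  have hdvd : derivative u ∣ derivX K u := by
    refine dvd_of_dvd_pow_of_derivation_eq (k := K) (n := 3)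
      ((derivative' : Derivation K[X] K[X][X] K[X][X]).restrictScalars K) (derivX K) hu
      (derivative_coeffDeriv _ u) ?_ ?_
    -- u_x · `h₂` minus `h₃` reads u_x³ = -u_y (u_x v_x + η_x).
    · exact ⟨-(derivX K u * derivX K v + derivX K η), by
        linear_combination derivX K u * h₂ - h₃⟩
    · intro p hp hpu hpd
      change p ∣ derivative p at hpd
      obtain ⟨q, hq⟩ := hpu
      -- A divisor of u_y inherits a unit leading coefficient, so a prime one has positive degree in
      -- y, and p ∣ p_y fails by degree.
      have hpl : IsUnit p.leadingCoeff := by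
        rw [hq, leadingCoeff_mul] at hlcu
        exact isUnit_of_mul_isUnit_left hlcu
      have hp0 : p.natDegree ≠ 0 := by
        intro h0
        rw [eq_C_of_natDegree_eq_zero h0] at hp
        rw [leadingCoeff, h0] at hpl
        exact hp.not_isUnit (hpl.map C)
      have h1 := natDegree_le_of_dvd hpd (derivative_ne_zero.mpr hp0)
      rw [natDegree_derivative] at h1
      omega
  obtain ⟨c, hc⟩ := hdvd
  refine ⟨c.coeff 0, ?_⟩
  -- ∂_x kills the constant leading coefficient of u, so deg_y u_x ≤ deg_y u_y and the quotient is
  -- free of y.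
  have hlt : (derivX K u).natDegree < u.natDegree := by
    refine lt_of_le_of_ne (natDegree_coeffDeriv_le _ u) fun h0 => ?_
    have h1 : (derivX K u).coeff u.natDegree = 0 := by
      rw [coeff_derivX, derivative_eq_zero, hlc]
    rw [← h0, coeff_natDegree, leadingCoeff_eq_zero] at h1
    rw [h1, natDegree_zero] at h0
    omega
  have hc0 : c.natDegree = 0 := by
    rcases eq_or_ne c 0 with rfl | hcne
    · simp
    rw [hc, natDegree_mul hu hcne, natDegree_derivative] at hlt
    omega
  rw [hc, mul_comm]
  congr 1
  exact eq_C_of_natDegree_eq_zero hc0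

/-- A polynomial killed by `∂/∂x - B'(x) ∂/∂y` is a polynomial in `y + B(x)`. -/
theorem exists_eq_comp_of_derivX_eq {u : K[X][X]} {B : K[X]}
    (h : derivX K u = C (derivative B) * derivative u) :
    ∃ g : K[X], u = (g.map C).comp (X + C B) := by
  have h0 : derivX K (u.comp (X - C B)) = 0 := by
    rw [coeffDeriv_comp, h, map_sub, coeffDeriv_X, derivX_C, mul_comp, C_comp]
    ring
  obtain ⟨g, hg⟩ : ∃ g : K[X], g.map C = u.comp (X - C B) := by
    rw [← mem_lifts, lifts_iff_coeff_lifts]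
    intro n
    have h1 : derivative ((u.comp (X - C B)).coeff n) = 0 := by
      rw [← coeff_derivX, h0, coeff_zero]
    exact ⟨_, (eq_C_of_derivative_eq_zero h1).symm⟩
  refine ⟨g, ?_⟩
  rw [hg, comp_assoc]
  simp

/-- Both u and η are killed by ∂_x - B'∂_y, and v = -B'u + w(x). Thus `h₂` becomes u_y (w' - B''u) +
η_y = 0, and the same operator turns it into u_y (w'' - B'''u) = 0. As u involves y, B''' = 0 and
w'' = 0. -/
theorem structure_of_relations {u v η : K[X][X]} (hu : derivative u ≠ 0)
    (h₁ : derivative v = -derivX K u)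
    (h₂ : derivX K u ^ 2 + derivative u * derivX K v + derivative η = 0)
    (h₃ : derivX K u * derivative η = derivative u * derivX K η)
    (hu0 : (u.coeff 0).coeff 0 = 0) (hv0 : (v.coeff 0).coeff 0 = 0)
    (hη0 : (η.coeff 0).coeff 0 = 0) :
    ∃ (g B : K[X]) (β l ω : K), B = C β * X ^ 2 + C l * X ∧ g.eval 0 = 0 ∧ 1 ≤ g.natDegree ∧
      u = (g.map C).comp (X + C B) ∧ v = -(C (derivative B) * u) + C (C ω * X) ∧
      η = C (C β) * u ^ 2 - C (C ω) * u := by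
  obtain ⟨c, hc⟩ := exists_derivX_eq_C_mul_derivative hu h₁ h₂ h₃
  obtain ⟨B, rfl, hB0⟩ := exists_derivative_eq c
  obtain ⟨g, hg⟩ := exists_eq_comp_of_derivX_eq hc
  have hdeg : u.natDegree ≠ 0 := derivative_ne_zero.mp hu
  have hη : derivX K η = C (derivative B) * derivative η := by
    refine mul_left_cancel₀ hu ?_
    rw [← h₃, hc]; ring
  -- the part of `v` that does not depend on `y`
  have hw : derivative (v + C (derivative B) * u) = 0 := by
    rw [derivative_add, derivative_C_mul, h₁, hc]; ring
  have hv := eq_C_of_derivative_eq_zero hw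
  set w : K[X] := (v + C (derivative B) * u).coeff 0 with hwdef
  have hv' : v = -(C (derivative B) * u) + C w := by linear_combination hv
  have huy : derivX K (derivative u) = C (derivative B) * derivative (derivative u) := by
    rw [← derivative_coeffDeriv, hc, derivative_C_mul]
  have hηy : derivX K (derivative η) = C (derivative B) * derivative (derivative η) := by
    rw [← derivative_coeffDeriv, hη, derivative_C_mul]
  have hvx : derivX K v = -(C (derivative (derivative B)) * u
      + C (derivative B) * (C (derivative B) * derivative u)) + C (derivative w) := by
    rw [hv', map_add, map_neg, Derivation.leibniz, derivX_C, derivX_C, hc]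
    simp only [smul_eq_mul]; ring
  have key : derivative u * (C (derivative w) - C (derivative (derivative B)) * u)
      + derivative η = 0 := by
    rw [hvx, hc] at h₂
    linear_combination h₂
  have kx := congrArg (derivX K) key
  have ky := congrArg derivative key
  simp only [map_add, map_sub, Derivation.leibniz, smul_eq_mul, derivX_C, huy, hηy, hc,
    map_zero] at kx
  simp only [derivative_add, derivative_sub, derivative_mul, derivative_C, derivative_zero] at ky
  have k0 : derivative u * (C (derivative (derivative w))
      - C (derivative (derivative (derivative B))) * u) = 0 := by
    linear_combination kx - C (derivative B) * ky
  have k1 := (mul_eq_zero.mp k0).resolve_left hu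
  have hB3 : derivative (derivative (derivative B)) = 0 := by
    have := congrArg (fun p : K[X][X] => p.coeff u.natDegree) k1
    simp only [coeff_sub, coeff_C_mul, coeff_zero, coeff_C_of_ne_zero hdeg, zero_sub,
      neg_eq_zero, mul_eq_zero] at this
    refine this.resolve_right fun h0 => hu ?_
    rw [coeff_natDegree, leadingCoeff_eq_zero] at h0
    simp [h0]
  have hw2 : derivative (derivative w) = 0 := by
    rw [hB3, C_0, zero_mul, sub_zero, C_eq_zero] at k1
    exact k1
  obtain ⟨ω, hω⟩ : ∃ ω, derivative w = C ω := ⟨_, eq_C_of_derivative_eq_zero hw2⟩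
  obtain ⟨β, hβ⟩ : ∃ β, derivative (derivative B) = C (2 * β) :=
    ⟨(derivative (derivative B)).coeff 0 / 2, by
      rw [mul_div_cancel₀ _ (two_ne_zero : (2 : K) ≠ 0)]
      exact eq_C_of_derivative_eq_zero hB3⟩
  obtain ⟨l, hl⟩ : ∃ l, derivative B = C (2 * β) * X + C l := by
    have h0 : derivative (derivative B - C (2 * β) * X) = 0 := by
      rw [derivative_sub, hβ, derivative_C_mul_X, sub_self]
    exact ⟨_, by linear_combination eq_C_of_derivative_eq_zero h0⟩
  have hB : B = C β * X ^ 2 + C l * X := by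
    have h0 : derivative (B - (C β * X ^ 2 + C l * X)) = 0 := by
      rw [derivative_sub, hl, derivative_add, derivative_C_mul_X_sq, derivative_C_mul_X,
        mul_comm β 2, sub_self]
    have h1 := eq_C_of_derivative_eq_zero h0
    rw [coeff_zero_eq_eval_zero] at h1
    simp only [eval_sub, eval_add, eval_mul, eval_C, eval_pow, eval_X, hB0] at h1
    simpa [sub_eq_zero] using h1
  have hww : w = C ω * X := by
    have h0 : derivative (w - C ω * X) = 0 := by
      rw [derivative_sub, hω, derivative_C_mul_X, sub_self]
    have h1 := eq_C_of_derivative_eq_zero h0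
    have h2 : w.coeff 0 = 0 := by
      rw [hwdef, coeff_add, coeff_C_mul, coeff_add, mul_coeff_zero, hu0, hv0]; simp
    simpa [h2, sub_eq_zero] using h1
  -- Setting y = 0 gives u(x, 0) = g(B(x)); as B(0) = 0, this yields g(0) = u(0, 0) = 0.
  have hgu : u.eval 0 = g.comp B := by
    rw [hg, eval_comp]
    simp [eval_map, comp]
  refine ⟨g, B, β, l, ω, hB, ?_, ?_, hg, by rw [← hww]; exact hv', ?_⟩
  · have h0 := congrArg (eval 0) hgu
    rw [eval_comp, hB0, ← coeff_zero_eq_eval_zero, ← coeff_zero_eq_eval_zero, hu0] at h0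
    exact h0.symm
  · by_contra h0
    have h1 : g.natDegree = 0 := by omega
    rw [hg, eq_C_of_natDegree_eq_zero h1] at hu
    simp at hu
  · have hy : derivative (η - (C (C β) * u ^ 2 - C (C ω) * u)) = 0 := by
      rw [hω, hβ] at key
      simp only [derivative_sub, derivative_C_mul, derivative_pow]
      simp only [C_mul, C_ofNat, map_natCast] at key ⊢
      push_cast
      linear_combination key
    have hx : derivX K (η - (C (C β) * u ^ 2 - C (C ω) * u)) = 0 := by
      simp only [derivative_sub, derivative_C_mul, derivative_pow] at hy
      simp only [map_sub, Derivation.leibniz, Derivation.leibniz_pow, derivX_C, hη, hc,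
        derivative_C, C_0, smul_eq_mul, nsmul_eq_mul]
      simp only [map_natCast] at hy ⊢
      linear_combination C (derivative B) * hy
    have h0 := eq_C_C_of_derivatives_eq_zero hy hx
    have h1 : ((η - (C (C β) * u ^ 2 - C (C ω) * u)).coeff 0).coeff 0 = 0 := by
      simp [pow_two, hη0, hu0, mul_coeff_zero]
    rw [h1, C_0, C_0] at h0
    exact sub_eq_zero.mp h0

end Bivariate
end Polynomial

namespace Polynomial

/-! ### Dependence on z -/

section Trivariate

variable {K : Type*} [Field K] [CharZero K]

/-- The derivation `∂/∂y` of `K[x][y]`, over `K`. -/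
noncomputable abbrev derivY (K : Type*) [Field K] : Derivation K K[X][X] K[X][X] :=
  (derivative' : Derivation K[X] K[X][X] K[X][X]).restrictScalars K

theorem eq_C_C_of_derivX_derivY {p : K[X][X]} (hy : derivY K p = 0) (hx : derivX K p = 0) :
    ∃ κ : K, p = C (C κ) :=
  ⟨_, eq_C_C_of_derivatives_eq_zero hy hx⟩

/-- If u_y = 0, then `h₂` times u_x together with `h₃` gives u_x³ = 0, so u is constant and vanishes
at 0. -/
theorem derivative_ne_zero_of_relations {u h : K[X][X]} {V : K[X][X][X]} (hu : u ≠ 0)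
    (hu0 : (u.coeff 0).coeff 0 = 0)
    (h₂ : C (derivX K u) ^ 2 + C (derivative u) * coeffDeriv (derivX K) V
      + derivative V * C (derivative h) = 0)
    (h₃ : derivative V * C (derivX K u * derivative h - derivative u * derivX K h) = 0) :
    derivative u ≠ 0 := by
  intro hy
  have hx : derivX K u = 0 := by
    rw [hy] at h₂ h₃
    rw [zero_mul, sub_zero] at h₃
    have h4 : C (derivX K u) ^ 3 = 0 := by
      rw [C_mul] at h₃
      rw [C_0] at h₂
      calc C (derivX K u) ^ 3
          = C (derivX K u) * (C (derivX K u) ^ 2 + 0 * coeffDeriv (derivX K) V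
            + derivative V * C (derivative h))
            - derivative V * (C (derivX K u) * C (derivative h)) := by ring
        _ = 0 := by rw [h₂, h₃]; ring
    simpa using h4
  have := eq_C_C_of_derivatives_eq_zero hy hx
  rw [hu0, C_0, C_0] at this
  exact hu this

/-- If deg_z V ≥ 2, the top coefficient is a constant κ ≠ 0 and the next is some q(x). The relation
between them gives h_y = s(x) u_y, so h = su + r(x). Since V_z ≠ 0, the Jacobian of (u, h) vanishes,
which forces s' = r' = 0 and makes h a multiple of u. -/
theorem eq_C_add_C_mul_X_of_relations {u h : K[X][X]} {V : K[X][X][X]} (hu : derivative u ≠ 0)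
    (hu0 : (u.coeff 0).coeff 0 = 0) (hh0 : (h.coeff 0).coeff 0 = 0)
    (hdep : ∀ κ : K, h ≠ C (C κ) * u)
    (h₁ : C (derivX K u) + coeffDeriv (derivY K) V = 0)
    (h₂ : C (derivX K u) ^ 2 + C (derivative u) * coeffDeriv (derivX K) V
      + derivative V * C (derivative h) = 0)
    (h₃ : derivative V * C (derivX K u * derivative h - derivative u * derivX K h) = 0) :
    ∃ (v : K[X][X]) (c : K), V = C v + C (C (C c)) * X := by
  have hy : ∀ i, derivY K (V.coeff (i + 1)) = 0 := fun i => by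
    have := congrArg (fun p => coeff p (i + 1)) h₁
    simpa [coeff_C_succ, coeff_coeffDeriv] using this
  have hz : ∀ i, derivative u * derivX K (V.coeff (i + 1))
      + V.coeff (i + 1 + 1) * ((i : K[X][X]) + 2) * derivative h = 0 := fun i => by
    have := congrArg (fun p => coeff p (i + 1)) h₂
    simp only [coeff_add, coeff_C_mul, coeff_mul_C, coeff_coeffDeriv, coeff_derivative,
      ← C_pow, coeff_C_succ, coeff_zero, zero_add] at this
    push_cast at this
    linear_combination this
  have hdeg : V.natDegree ≤ 1 := by
    by_contra hlt
    obtain ⟨e, he⟩ : ∃ e, V.natDegree = e + 1 + 1 := ⟨V.natDegree - 2, by omega⟩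
    have hV : derivative V ≠ 0 := derivative_ne_zero.mpr (by omega)
    have hjac := (mul_eq_zero.mp h₃).resolve_left hV
    rw [C_eq_zero] at hjac
    have htop : derivX K (V.coeff (e + 1 + 1)) = 0 := by
      have := hz (e + 1)
      rw [coeff_eq_zero_of_natDegree_lt (n := e + 1 + 1 + 1) (by omega), zero_mul, zero_mul,
        add_zero] at this
      exact (mul_eq_zero.mp this).resolve_left hu
    obtain ⟨κ, hκ⟩ := eq_C_C_of_derivX_derivY (hy (e + 1)) htop
    have hκ0 : κ ≠ 0 := by
      rintro rfl
      rw [C_0, C_0, ← he, coeff_natDegree, leadingCoeff_eq_zero] at hκ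
      simp [hκ] at hV
    have hsub : V.coeff (e + 1) = C ((V.coeff (e + 1)).coeff 0) := eq_C_of_derivative_eq_zero (hy e)
    set q := (V.coeff (e + 1)).coeff 0
    have hμ : κ * ((e : K) + 2) ≠ 0 :=
      mul_ne_zero hκ0 (by exact_mod_cast (by omega : e + 2 ≠ 0))
    obtain ⟨s, hs⟩ : ∃ s : K[X], derivative h = C s * derivative u := by
      refine ⟨C (-(κ * ((e : K) + 2))⁻¹) * derivative q, ?_⟩
      have h4 := hz e
      rw [hκ, hsub, derivX_C] at h4
      have h5 : C (C (κ * ((e : K) + 2))⁻¹) * C (C (κ * ((e : K) + 2))) = (1 : K[X][X]) := by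
        rw [← C_mul, ← C_mul, inv_mul_cancel₀ hμ, C_1, C_1]
      simp only [C_mul, C_neg, C_add, map_natCast, C_ofNat] at h5 ⊢
      linear_combination C (C (κ * ((e : K) + 2))⁻¹) * h4 - derivative h * h5
    have hr := eq_C_of_derivative_eq_zero
      (p := h - C s * u) (by rw [derivative_sub, derivative_C_mul, hs, sub_self])
    set r := (h - C s * u).coeff 0 with hrdef
    have hh : h = C s * u + C r := by linear_combination hr
    have hhx : derivX K h = C s * derivX K u + u * C (derivative s) + C (derivative r) := by
      rw [hh, map_add, Derivation.leibniz, derivX_C, derivX_C, smul_eq_mul, smul_eq_mul]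
    rw [hhx, hs] at hjac
    have h6 : derivative u * (C (derivative s) * u + C (derivative r)) = 0 := by
      linear_combination -hjac
    have h7 := (mul_eq_zero.mp h6).resolve_left hu
    have hs0 : derivative s = 0 := by
      have hd : u.natDegree ≠ 0 := derivative_ne_zero.mp hu
      have := congrArg (fun p => coeff p u.natDegree) h7
      simp only [coeff_add, coeff_C_mul, coeff_zero, coeff_C_of_ne_zero hd, add_zero,
        mul_eq_zero] at this
      refine this.resolve_right fun h0 => hd ?_
      rw [coeff_natDegree, leadingCoeff_eq_zero] at h0
      simp [h0]
    rw [hs0, C_0, zero_mul, zero_add, C_eq_zero] at h7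
    have hr0 : r.coeff 0 = 0 := by
      rw [hrdef, coeff_sub, coeff_C_mul, coeff_sub, mul_coeff_zero, hu0, hh0]; simp
    have hr1 := eq_C_of_derivative_eq_zero h7
    rw [hr0, C_0] at hr1
    refine hdep (s.coeff 0) ?_
    rw [← eq_C_of_derivative_eq_zero hs0, hh, hr1, C_0, add_zero]
  have hx1 : derivX K (V.coeff 1) = 0 := by
    have := hz 0
    rw [coeff_eq_zero_of_natDegree_lt (n := 0 + 1 + 1) (by omega), zero_mul, zero_mul,
      add_zero] at this
    exact (mul_eq_zero.mp this).resolve_left hu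
  obtain ⟨c, hc⟩ := eq_C_C_of_derivX_derivY (hy 0) hx1
  refine ⟨V.coeff 0, c, ?_⟩
  rw [← hc, zero_add, add_comm]
  exact eq_X_add_C_of_natDegree_le_one hdeg

theorem structure_of_nilpotent_relations {u h : K[X][X]} {V : K[X][X][X]} (hu : u ≠ 0)
    (hu0 : (u.coeff 0).coeff 0 = 0) (hh0 : (h.coeff 0).coeff 0 = 0)
    (hV0 : ((V.coeff 0).coeff 0).coeff 0 = 0)
    (hdep : ∀ κ : K, h ≠ C (C κ) * u) (hVdep : ∀ κ : K, V ≠ C (C (C κ)) * C u)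
    (h₁ : C (derivX K u) + coeffDeriv (derivY K) V = 0)
    (h₂ : C (derivX K u) ^ 2 + C (derivative u) * coeffDeriv (derivX K) V
      + derivative V * C (derivative h) = 0)
    (h₃ : derivative V * C (derivX K u * derivative h - derivative u * derivX K h) = 0) :
    ∃ (g B : K[X]) (c c₀ l l₂ : K), c ≠ 0 ∧ c₀ ≠ 0 ∧ g.eval 0 = 0 ∧ 1 ≤ g.natDegree ∧
      B = C (c * c₀) * X ^ 2 + C l * X ∧ u = (g.map C).comp (X + C B) ∧
      V = C (C (C c)) * X - C (C (derivative B)) * C u - C (C (C (c * l₂))) * C (C X) ∧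
      h = C (C c₀) * u ^ 2 + C (C l₂) * u := by
  have huy := derivative_ne_zero_of_relations hu hu0 h₂ h₃
  obtain ⟨v, c, rfl⟩ := eq_C_add_C_mul_X_of_relations huy hu0 hh0 hdep h₁ h₂ h₃
  have e₁ : derivative v = -derivX K u := by
    have := congrArg (fun p => coeff p 0) h₁
    simp only [coeff_add, coeff_C_zero, coeff_coeffDeriv, coeff_mul_X_zero, add_zero,
      coeff_zero] at this
    change derivX K u + derivative v = 0 at this
    linear_combination this
  have e₂ : derivX K u ^ 2 + derivative u * derivX K v + derivative (C (C c) * h) = 0 := by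
    have := congrArg (fun p => coeff p 0) h₂
    simp only [coeff_add, coeff_C_zero, coeff_coeffDeriv, coeff_mul_X_zero, add_zero,
      coeff_zero, coeff_mul_C, coeff_C_mul, ← C_pow, derivative_add, derivative_C,
      derivative_C_mul_X, zero_add] at this
    rw [derivative_C_mul]
    exact this
  have e₃ : derivX K u * derivative (C (C c) * h) = derivative u * derivX K (C (C c) * h) := by
    rw [derivative_add, derivative_C, derivative_C_mul_X, zero_add, ← C_mul, C_eq_zero] at h₃
    rw [derivative_C_mul, Derivation.leibniz, derivX_C, derivative_C, C_0, smul_zero, add_zero,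
      smul_eq_mul]
    linear_combination h₃
  obtain ⟨g, B, β, l, ω, hB, hg0, hg1, hug, hv, hη⟩ :=
    structure_of_relations huy e₁ e₂ e₃ hu0 (by simpa using hV0) (by simp [hh0])
  have hdeg : u.natDegree ≠ 0 := derivative_ne_zero.mp huy
  -- If c = 0 then η = 0, so βu = ω with u nonconstant. Hence β = ω = 0, B = lx and V = -lu,
  -- contrary to independence.
  have hc : c ≠ 0 := by
    rintro rfl
    have k0 : C (C β) * u - C (C ω) = 0 := by
      refine (mul_eq_zero.mp ?_).resolve_left hu
      rw [C_0, C_0, zero_mul] at hη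
      linear_combination -hη
    have hβ : β = 0 := by
      have := congrArg (fun p => coeff p u.natDegree) k0
      simp only [coeff_sub, coeff_C_mul, coeff_zero, coeff_C_of_ne_zero hdeg, sub_zero,
        mul_eq_zero, C_eq_zero, coeff_natDegree, leadingCoeff_eq_zero, hu, or_false] at this
      exact this
    have hω : ω = 0 := by simpa [hβ] using k0
    refine hVdep (-l) ?_
    rw [hv, hB, hβ, hω]
    simp
    ring
  have hinv : C (C c⁻¹) * C (C c) = (1 : K[X][X]) := by
    rw [← C_mul, ← C_mul, inv_mul_cancel₀ hc, C_1, C_1]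
  have hh : h = C (C (β / c)) * u ^ 2 + C (C (-ω / c)) * u := by
    simp only [div_eq_mul_inv, C_mul, C_neg]
    linear_combination C (C c⁻¹) * hη - h * hinv
  refine ⟨g, B, c, β / c, l, -ω / c, hc, ?_, hg0, hg1, ?_, hug, ?_, hh⟩
  · intro h0
    rw [h0] at hh
    exact hdep (-ω / c) (by simpa using hh)
  · rw [mul_div_cancel₀ _ hc, hB]
  · rw [mul_div_cancel₀ _ hc, hv]
    simp only [C_add, C_mul, C_neg]
    ring

end Trivariate
end Polynomial

/-! ### Passage to iterated polynomial rings, and nilpotent 3×3 matrices -/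

section Transfer

variable {K : Type*} [Field K]

/-- `K[x, y]` as `K[x][y]`. -/
noncomputable def toXY (K : Type*) [Field K] :
    MvPolynomial (Fin 2) K →ₐ[K] Polynomial (Polynomial K) :=
  aeval ![Polynomial.C Polynomial.X, Polynomial.X]

/-- `K[x, y, z]` as `K[x][y][z]`. -/
noncomputable def toXYZ (K : Type*) [Field K] :
    MvPolynomial (Fin 3) K →ₐ[K] Polynomial (Polynomial (Polynomial K)) :=
  aeval (R := K) (S₁ := Polynomial (Polynomial (Polynomial K)))
    ![Polynomial.C (Polynomial.C Polynomial.X), Polynomial.C Polynomial.X, Polynomial.X]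

theorem toXYZ_X_zero : toXYZ K (X 0) = Polynomial.C (Polynomial.C Polynomial.X) :=
  aeval_X _ _

theorem toXYZ_X_one : toXYZ K (X 1) = Polynomial.C Polynomial.X :=
  aeval_X _ _

theorem toXYZ_X_two : toXYZ K (X 2) = Polynomial.X :=
  aeval_X _ _

theorem toXYZ_liftXY (p : MvPolynomial (Fin 2) K) :
    toXYZ K (liftXY p) = Polynomial.C (toXY K p) := by
  rw [liftXY, toXYZ, toXY, aeval_rename]
  induction p using MvPolynomial.induction_on with
  | C a => simp [Polynomial.algebraMap_apply]
  | add p q hp hq => simp [hp, hq]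
  | mul_X p i hp =>
    rw [map_mul, map_mul, hp, map_mul, aeval_X, aeval_X]
    fin_cases i <;> rfl

theorem MvPolynomial.map_pderiv_eq_derivation {σ B : Type*} [CommSemiring B] [Algebra K B]
    (φ : MvPolynomial σ K →ₐ[K] B) (D : Derivation K B B) (i : σ)
    (h : ∀ j, φ (pderiv i (X j)) = D (φ (X j))) (p : MvPolynomial σ K) :
    φ (pderiv i p) = D (φ p) := by
  induction p using MvPolynomial.induction_on with
  | C a =>
    rw [pderiv_C, map_zero, ← MvPolynomial.algebraMap_eq, AlgHom.commutes, Derivation.map_algebraMap]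
  | add p q hp hq => simp only [map_add, hp, hq]
  | mul_X p j hp => simp only [Derivation.leibniz, map_add, map_mul, smul_eq_mul, hp, h]

theorem toXYZ_pderiv_zero (p : MvPolynomial (Fin 3) K) :
    toXYZ K (pderiv 0 p) = Polynomial.coeffDeriv (Polynomial.derivX K) (toXYZ K p) := by
  refine map_pderiv_eq_derivation (B := Polynomial (Polynomial (Polynomial K))) (toXYZ K) _ _ (fun j => ?_) p
  fin_cases j <;>
    simp [toXYZ, pderiv_X, Polynomial.coeffDeriv_X, Polynomial.coeffDeriv_C]

theorem toXYZ_pderiv_one (p : MvPolynomial (Fin 3) K) :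
    toXYZ K (pderiv 1 p) = Polynomial.coeffDeriv (Polynomial.derivY K) (toXYZ K p) := by
  refine map_pderiv_eq_derivation (B := Polynomial (Polynomial (Polynomial K))) (toXYZ K) _ _ (fun j => ?_) p
  fin_cases j <;> simp [toXYZ, pderiv_X, Polynomial.coeffDeriv_X, Polynomial.coeffDeriv_C]

theorem toXYZ_pderiv_two (p : MvPolynomial (Fin 3) K) :
    toXYZ K (pderiv 2 p) = Polynomial.derivative (toXYZ K p) := by
  refine map_pderiv_eq_derivation (B := Polynomial (Polynomial (Polynomial K))) (toXYZ K)
    ((Polynomial.derivative' : Derivation (Polynomial (Polynomial K)) _ _).restrictScalars K)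
    _ (fun j => ?_) p
  fin_cases j <;> simp [toXYZ, pderiv_X]

theorem toXY_injective : Function.Injective (toXY K) := by
  let ψ : Polynomial (Polynomial K) →+* MvPolynomial (Fin 2) K :=
    Polynomial.eval₂RingHom (Polynomial.aeval (X 0)).toRingHom (X 1)
  refine Function.LeftInverse.injective (g := ψ) fun p => ?_
  induction p using MvPolynomial.induction_on with
  | C a => simp [ψ, toXY, Polynomial.algebraMap_apply, MvPolynomial.algebraMap_eq]
  | add p q hp hq => rw [map_add, map_add, hp, hq]
  | mul_X p i hp =>
    rw [map_mul, map_mul, hp]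
    congr 1
    fin_cases i <;> simp [ψ, toXY]

theorem toXYZ_injective : Function.Injective (toXYZ K) := by
  let ψ : Polynomial (Polynomial K) →+* MvPolynomial (Fin 3) K :=
    Polynomial.eval₂RingHom (Polynomial.aeval (X 0)).toRingHom (X 1)
  let χ : Polynomial (Polynomial (Polynomial K)) →+* MvPolynomial (Fin 3) K :=
    Polynomial.eval₂RingHom ψ (X 2)
  refine Function.LeftInverse.injective (g := χ) fun p => ?_
  induction p using MvPolynomial.induction_on with
  | C a => simp [χ, ψ, toXYZ, Polynomial.algebraMap_apply, MvPolynomial.algebraMap_eq]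
  | add p q hp hq => rw [map_add, map_add, hp, hq]
  | mul_X p i hp =>
    rw [map_mul, map_mul, hp]
    refine congrArg (p * ·) ?_
    obtain rfl | rfl | rfl : i = 0 ∨ i = 1 ∨ i = 2 := by fin_cases i <;> simp
    · rw [toXYZ_X_zero]; simp [χ, ψ]
    · rw [toXYZ_X_one]; simp [χ, ψ]
    · rw [toXYZ_X_two]; simp [χ]

theorem coeff_toXY (p : MvPolynomial (Fin 2) K) :
    ((toXY K p).coeff 0).coeff 0 = eval 0 p := by
  induction p using MvPolynomial.induction_on with
  | C a => simp [toXY, Polynomial.algebraMap_apply]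
  | add p q hp hq => simp only [map_add, Polynomial.coeff_add, hp, hq]
  | mul_X p i hp =>
    rw [map_mul, Polynomial.mul_coeff_zero, Polynomial.mul_coeff_zero, hp, map_mul]
    congr 1
    fin_cases i <;> simp [toXY]

theorem coeff_toXYZ (p : MvPolynomial (Fin 3) K) :
    (((toXYZ K p).coeff 0).coeff 0).coeff 0 = eval 0 p := by
  induction p using MvPolynomial.induction_on with
  | C a => simp [toXYZ, Polynomial.algebraMap_apply]
  | add p q hp hq => simp only [map_add, Polynomial.coeff_add, hp, hq]
  | mul_X p i hp =>
    rw [map_mul, Polynomial.mul_coeff_zero, Polynomial.mul_coeff_zero, Polynomial.mul_coeff_zero,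
      hp, map_mul]
    refine congrArg (eval 0 p * ·) ?_
    obtain rfl | rfl | rfl : i = 0 ∨ i = 1 ∨ i = 2 := by fin_cases i <;> simp
    · rw [toXYZ_X_zero]; simp
    · rw [toXYZ_X_one]; simp
    · rw [toXYZ_X_two]; simp

theorem toXY_C (a : K) : toXY K (C a) = Polynomial.C (Polynomial.C a) := by
  simp [toXY, Polynomial.algebraMap_apply]

theorem toXYZ_C (a : K) :
    toXYZ K (C a) = Polynomial.C (Polynomial.C (Polynomial.C a)) := by
  simp [toXYZ, Polynomial.algebraMap_apply]

theorem toXY_aeval_X (q : Polynomial K) :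
    toXY K (Polynomial.aeval (X 0) q) = Polynomial.C q := by
  rw [← Polynomial.aeval_algHom_apply]
  have h : toXY K (X 0) = Polynomial.C Polynomial.X := by simp [toXY]
  rw [h]
  induction q using Polynomial.induction_on' with
  | add p q hp hq => simp only [map_add, hp, hq]
  | monomial n a =>
    rw [Polynomial.aeval_monomial, ← Polynomial.C_pow, ← Polynomial.C_mul_X_pow_eq_monomial,
      Polynomial.C_mul]
    rfl

theorem aeval_eq_map_C_comp (g : Polynomial K) (s : Polynomial (Polynomial K)) :
    Polynomial.aeval s g = (g.map Polynomial.C).comp s := by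
  rw [Polynomial.comp, Polynomial.eval₂_map]
  rfl

/-- These are tr M = 0, tr M² = 0 and det M = 0. After d = -a, the second is twice the stated
expression, hence `h2`. -/
theorem Matrix.relations_of_isNilpotent_fin_three {R : Type*} [CommRing R] [IsDomain R]
    (h2 : (2 : R) ≠ 0) {a b c d e f g : R}
    (hM : IsNilpotent !![a, b, 0; c, d, e; f, g, 0]) :
    a + d = 0 ∧ a ^ 2 + b * c + e * g = 0 ∧ e * (a * g - b * f) = 0 := by
  have ht := (Matrix.isNilpotent_trace_of_isNilpotent hM).eq_zero
  have ht2 := (Matrix.isNilpotent_trace_of_isNilpotent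
    ((Commute.refl _).isNilpotent_mul_left hM)).eq_zero
  have hd : Matrix.det !![a, b, 0; c, d, e; f, g, 0] = 0 := by
    obtain ⟨k, hk⟩ := hM
    have h := congrArg Matrix.det hk
    rw [Matrix.det_pow, Matrix.det_zero] at h
    exact eq_zero_of_pow_eq_zero h
  simp only [Matrix.trace_fin_three, Matrix.mul_apply, Fin.sum_univ_three, Matrix.of_apply,
    Matrix.cons_val', Matrix.cons_val_zero, Matrix.cons_val_one, Matrix.cons_val,
    Matrix.cons_val_fin_one] at ht ht2
  rw [Matrix.det_fin_three] at hd
  simp only [Matrix.of_apply, Matrix.cons_val', Matrix.cons_val_zero, Matrix.cons_val_one,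
    Matrix.cons_val, Matrix.cons_val_fin_one] at hd
  have had : d = -a := by linear_combination ht
  subst had
  refine ⟨by ring, (mul_eq_zero.mp ?_).resolve_left h2, ?_⟩
  · linear_combination ht2
  · linear_combination -hd

end Transfer

/-! ### The map H and the final statement -/

theorem relations_of_isNilpotent_jacobianMatrix {K : Type*} [Field K] [CharZero K]
    {u : MvPolynomial (Fin 2) K} {v : MvPolynomial (Fin 3) K} {h : MvPolynomial (Fin 2) K}
    (hnil : IsNilpotent (jacobianMatrix (mapUVH u v h))) :
    Polynomial.C (Polynomial.derivX K (toXY K u))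
        + Polynomial.coeffDeriv (Polynomial.derivY K) (toXYZ K v) = 0 ∧
      Polynomial.C (Polynomial.derivX K (toXY K u)) ^ 2
        + Polynomial.C (Polynomial.derivative (toXY K u))
          * Polynomial.coeffDeriv (Polynomial.derivX K) (toXYZ K v)
        + Polynomial.derivative (toXYZ K v)
          * Polynomial.C (Polynomial.derivative (toXY K h)) = 0 ∧
      Polynomial.derivative (toXYZ K v)
        * Polynomial.C (Polynomial.derivX K (toXY K u) * Polynomial.derivative (toXY K h)
          - Polynomial.derivative (toXY K u) * Polynomial.derivX K (toXY K h)) = 0 := by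
  have hM : jacobianMatrix (mapUVH u v h) =
      !![pderiv 0 (liftXY u), pderiv 1 (liftXY u), 0;
        pderiv 0 v, pderiv 1 v, pderiv 2 v;
        pderiv 0 (liftXY h), pderiv 1 (liftXY h), 0] := by
    have hz : ∀ p : MvPolynomial (Fin 2) K, pderiv 2 (liftXY p) = 0 := fun p =>
      toXYZ_injective (by
        rw [toXYZ_pderiv_two, toXYZ_liftXY, Polynomial.derivative_C, map_zero])
    ext1 i j
    fin_cases i <;> fin_cases j <;> simp [jacobianMatrix, mapUVH, hz]
  rw [hM] at hnil
  obtain ⟨h₁, h₂, h₃⟩ := Matrix.relations_of_isNilpotent_fin_three two_ne_zero hnil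
  have hx : ∀ p : MvPolynomial (Fin 2) K, toXYZ K (pderiv 0 (liftXY p))
      = Polynomial.C (Polynomial.derivX K (toXY K p)) := fun p => by
    rw [toXYZ_pderiv_zero, toXYZ_liftXY, Polynomial.coeffDeriv_C]
  have hy : ∀ p : MvPolynomial (Fin 2) K, toXYZ K (pderiv 1 (liftXY p))
      = Polynomial.C (Polynomial.derivative (toXY K p)) := fun p => by
    rw [toXYZ_pderiv_one, toXYZ_liftXY, Polynomial.coeffDeriv_C]; rfl
  refine ⟨?_, ?_, ?_⟩
  · rw [← toXYZ_pderiv_one, ← hx, ← map_add, h₁, map_zero]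
  · rw [← toXYZ_pderiv_zero, ← toXYZ_pderiv_two, ← hx, ← hy, ← hy, ← map_pow, ← map_mul,
      ← map_mul, ← map_add, ← map_add, h₂, map_zero]
  · rw [← toXYZ_pderiv_two, Polynomial.C_sub, Polynomial.C_mul, Polynomial.C_mul, ← hx, ← hx,
      ← hy, ← hy, ← map_mul, ← map_mul, ← map_sub, ← map_mul, h₃, map_zero]

theorem theorem2p5 {K : Type*} [Field K] [IsAlgClosed K] [CharZero K]
    (u : MvPolynomial (Fin 2) K) (v : MvPolynomial (Fin 3) K) (h : MvPolynomial (Fin 2) K)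
    (hzero : ∀ i, eval (0 : Fin 3 → K) (mapUVH u v h i) = 0)
    (hindep : LinearIndependent K (mapUVH u v h))
    (hnil : IsNilpotent (jacobianMatrix (mapUVH u v h)))
    (hirr : ∀ Q : MvPolynomial (Fin 2) K,
      pderiv 1 Q ∣ pderiv 1 u → pderiv 1 Q ∣ pderiv 1 h →
      degreeOf 1 Q ∣ Nat.gcd (degreeOf 1 u) (degreeOf 1 h) →
      -- nothing is required of an empty variety, i.e. of a nonzero constant `Q_y`
      (planeVariety (pderiv 1 Q)).Nonempty →
      IsIrreducibleVariety (planeVariety (pderiv 1 Q))) :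
    ∃ (g b : Polynomial K) (v₁ c₀ a l₁ l₂ l₂' : K),
      v₁ ≠ 0 ∧ c₀ ≠ 0 ∧ a ≠ 0 ∧
      g.eval 0 = 0 ∧ 1 ≤ g.natDegree ∧
      b = Polynomial.C (v₁ * c₀ * a) * Polynomial.X ^ 2 + Polynomial.C l₁ * Polynomial.X
        + Polynomial.C l₂' ∧
      u = Polynomial.aeval (C a * X 1 + Polynomial.aeval (X 0) b) g ∧
      v = C v₁ * X 2
        - C a⁻¹ * Polynomial.aeval (X 0) (Polynomial.derivative b)
            * Polynomial.aeval (C a * X 1 + Polynomial.aeval (X 0) b) g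
        - C (v₁ * l₂) * X 0 ∧
      h = C c₀ * u ^ 2 + C l₂ * u := by
  obtain ⟨h₁, h₂, h₃⟩ := relations_of_isNilpotent_jacobianMatrix hnil
  have eval_lift : ∀ p : MvPolynomial (Fin 2) K, eval 0 (liftXY p) = eval 0 p := fun p => by
    rw [liftXY, eval_rename]; rfl
  have hu0 : ((toXY K u).coeff 0).coeff 0 = 0 := by
    rw [coeff_toXY, ← eval_lift]; exact hzero 0
  have hV0 : (((toXYZ K v).coeff 0).coeff 0).coeff 0 = 0 := by
    rw [coeff_toXYZ]; exact hzero 1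
  have hh0 : ((toXY K h).coeff 0).coeff 0 = 0 := by
    rw [coeff_toXY, ← eval_lift]; exact hzero 2
  have hli := Fintype.linearIndependent_iff.mp hindep
  have hune : toXY K u ≠ 0 := fun h0 => by
    refine hindep.ne_zero 0 (toXYZ_injective ?_)
    rw [map_zero]
    change toXYZ K (liftXY u) = 0
    rw [toXYZ_liftXY, h0, Polynomial.C_0]
  have hdep : ∀ κ : K, toXY K h ≠ Polynomial.C (Polynomial.C κ) * toXY K u := fun κ h0 => by
    have h1 : h = C κ * u := toXY_injective (by rw [h0, map_mul, toXY_C])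
    refine one_ne_zero (hli ![-κ, 0, 1] ?_ 2)
    rw [Fin.sum_univ_three]
    simp [mapUVH, h1, liftXY, MvPolynomial.smul_eq_C_mul]
  have hVdep : ∀ κ : K, toXYZ K v ≠
      Polynomial.C (Polynomial.C (Polynomial.C κ)) * Polynomial.C (toXY K u) := fun κ h0 => by
    have h1 : v = C κ * liftXY u := toXYZ_injective (by rw [h0, map_mul, toXYZ_C, toXYZ_liftXY])
    refine one_ne_zero (hli ![-κ, 1, 0] ?_ 1)
    rw [Fin.sum_univ_three]
    simp [mapUVH, h1, liftXY, MvPolynomial.smul_eq_C_mul]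
  obtain ⟨g, B, c, c₀, l, l₂, hc, hc₀, hg0, hg1, hB, hu, hv, hh⟩ :=
    Polynomial.structure_of_nilpotent_relations hune hu0 hh0 hV0 hdep hVdep h₁ h₂ h₃
  have hu' : u = Polynomial.aeval (C 1 * X 1 + Polynomial.aeval (X 0) B) g := by
    refine toXY_injective ?_
    rw [← Polynomial.aeval_algHom_apply, map_add, toXY_aeval_X, C_1, one_mul, hu,
      aeval_eq_map_C_comp]
    simp [toXY]
  have hlift : liftXY u = Polynomial.aeval (C 1 * X 1 + Polynomial.aeval (X 0) B) g := by
    conv_lhs => rw [hu']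
    rw [liftXY, ← Polynomial.aeval_algHom_apply, map_add, ← Polynomial.aeval_algHom_apply]
    simp
  -- The scaling a and the constant term of b can be absorbed into g, so a = 1 and zero constant
  -- term suffice.
  refine ⟨g, B, c, c₀, 1, l, l₂, 0, hc, hc₀, one_ne_zero, hg0, hg1, ?_, hu', ?_, ?_⟩
  · rw [hB, mul_one, Polynomial.C_0, add_zero]
  · rw [← hlift]
    have hB' : toXYZ K (Polynomial.aeval (X 0) (Polynomial.derivative B))
        = Polynomial.C (Polynomial.C (Polynomial.derivative B)) := by
      rw [← toXY_aeval_X, ← toXYZ_liftXY, liftXY, ← Polynomial.aeval_algHom_apply (rename _),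
        rename_X]
      rfl
    refine toXYZ_injective ?_
    rw [inv_one, C_1, one_mul, map_sub, map_sub, map_mul, map_mul, map_mul, toXYZ_C, toXYZ_C,
      hB', toXYZ_liftXY, toXYZ_X_zero, toXYZ_X_two, hv]
  · refine toXY_injective ?_
    rw [map_add, map_mul, map_mul, map_pow, toXY_C, toXY_C, hh]
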